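/- For a word $\alpha$ let $\mathrm{alph}(\alpha)$ be the set of letters occurring in $\alpha$ and $|\alpha|_a$ the number of occurrences of the letter $a$ in $\alpha$. For a finite set $B$ of letters let $(\alpha)_B$ be the word obtained from $\alpha$ by deleting all letters outside $B$ and then replacing each maximal run $aa\cdots a$ of one letter by the single letter $a$. A permutation of $B$ is a nonempty word over $B$ in which each letter of $B$ occurs exactly once. For positive integers $m,q$ let $N(m,q)$ be the least positive integer $M$ such that for every word $\alpha$ with $|\mathrm{alph}(\alpha)|\ge M$ and $|\alpha|_a\le q$ for each $a\in\mathrm{alph}(\alpha)$ there exist $A\subseteq\mathrm{alph}(\alpha)$ with $|A|=m$, a number $p\in\{1,\ldots,q\}$ and words $\alpha_1,\ldots,\alpha_p$ with $\alpha=\alpha_1\cdots\alpha_p$ such that $(\alpha_i)_A$ is a permutation of $A$ for $i=1,\ldots,p$ (such an $M$ always exists). Theorem. Let $\alpha$ be a word and let $k\ge 2$, $n\ge 1$, $q\ge 2$ be integers such that (1) $|\mathrm{alph}(\alpha)|\ge N(n^{(q-1)^2}k^{2q-3},q)$, and (2) $|\alpha|_a\le q$ for each $a\in\mathrm{alph}(\alpha)$.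 Then there exist $B\subseteq\mathrm{alph}(\alpha)$, $p\in\{1,2,\ldots,q\}$ and a factorization $\alpha=\alpha_1\alpha_2\cdots\alpha_p$ for which (3) $|B|=n^{p-1}k$; (4) $B\subseteq\mathrm{alph}(\alpha_i)$ and $(\alpha_i)_B$ is a permutation of $B$ for $i=1,2,\ldots,p$; and (5) for each $i\in\{1,2,\ldots,p-1\}$, if $(\alpha_i)_B=z_1z_2\cdots z_{n^{p-i}k}$ is the factorization of $(\alpha_i)_B$ into $n^{p-i}k$ blocks of equal length $n^{i-1}$ and $(\alpha_{i+1})_B=u_1u_2\cdots u_{n^{p-i-1}k}$ is the factorization of $(\alpha_{i+1})_B$ into $n^{p-i-1}k$ blocks of equal length $n^{i}$, then for each $j_1\in\{1,\ldots,n^{p-i}k\}$ there exists $j_2\in\{1,\ldots,n^{p-i-1}k\}$ such that $\mathrm{alph}(z_{j_1})\subseteq\mathrm{alph}(u_{j_2})$. -/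

import Mathlib

namespace WordComb

/-- The set `alph(α)` of all letters that occur in the word `α`. -/
def alph {A : Type*} [DecidableEq A] (α : List A) : Finset A :=
  α.toFinset

/-- The word `(α)_B`: delete from `α` all letters outside `B`, then replace every maximal run
`a a ⋯ a` of one letter by the single letter `a`. -/
def reduct {A : Type*} [DecidableEq A] (B : Finset A) (α : List A) : List A :=
  (α.filter (fun a => a ∈ B)).destutter (fun a b => a ≠ b)

/-- `β` is a permutation of `B`: a nonempty word over `B` in which each letter of `B` occurs
exactly once. -/
def IsPermutationOf {A : Type*} [DecidableEq A] (β : List A) (B : Finset A) : Prop :=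
  β ≠ [] ∧ (∀ a ∈ β, a ∈ B) ∧ ∀ a ∈ B, β.count a = 1

/-- `α = w 0 ⋯ w (p - 1)`; the factors may be arbitrary words. -/
def IsFactorization {A : Type*} (α : List A) {p : ℕ} (w : Fin p → List A) : Prop :=
  α = (List.ofFn w).flatten

/-- `β = z 0 ⋯ z (d - 1)` with all blocks `z j` of length `s`. For given `β`, `d`, `s` there is
at most one such `z`. -/
def IsBlockFactorization {A : Type*} (β : List A) (d s : ℕ) (z : Fin d → List A) : Prop :=
  IsFactorization β z ∧ ∀ j, (z j).length = s

/-- Every word with at least `M` distinct letters, each occurring at most `q` times, has a set `B`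
of `m` letters and a factorization into `p` factors, `1 ≤ p ≤ q`, each of which induces a
permutation of `B`. Letters are natural numbers; this is no restriction, since a word has finitely
many letters and these can be renamed. -/
def ForcesPermutations (m q M : ℕ) : Prop :=
  ∀ α : List ℕ, M ≤ (alph α).card → (∀ a ∈ alph α, α.count a ≤ q) →
    ∃ B : Finset ℕ, B ⊆ alph α ∧ B.card = m ∧
      ∃ p : ℕ, 1 ≤ p ∧ p ≤ q ∧
        ∃ w : Fin p → List ℕ, IsFactorization α w ∧
          ∀ i, IsPermutationOf (reduct B (w i)) B

/-- `N(m, q)`: the least positive integer `M` with `ForcesPermutations m q M`. -/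
noncomputable def N (m q : ℕ) : ℕ :=
  sInf {M : ℕ | 0 < M ∧ ForcesPermutations m q M}

end WordComb

/-!
The word `(w)_B` is a permutation of `B` exactly when `B` is nonempty, every letter of `B` occurs
in `w`, and no `a b a` with distinct `a, b ∈ B` is a subword of `w` (`Separates`). In this form the
property passes to nonempty subsets of `B`, and `(w)_C` for `C ⊆ B` arises from `(w)_B` by deleting
letters.

*The number `N(m, q)` exists.* Consider the interval between the first and the last occurrence of
each letter. Among many letters either `m` have pairwise disjoint intervals, and the whole word
separates them, or many have intervals that straddle one cut of the word
(`exists_cut_or_separates`). In the second case, pass to letters with the same number `c` of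
occurrences left of the cut, at most `q - c` remaining on the right, and use induction on both
sides (`exists_forcing`). Hence the hypothesis on `|alph α|` provides `p ≤ q` factors that all
induce permutations of one set of `n ^ ((q - 1) ^ 2) * k ^ (2 * q - 3)` letters.

*Nested blocks.* The set is thinned along the permutations from the last one to the second. The
last is cut into `k` intervals. When `K` classes have been found, one cuts each of them into `n`
classes that are intervals of the previous permutation: scan this permutation until some class that
still lacks parts shows `s` letters, make these letters a part of it, drop the scanned prefix, and
go on. Each of the `K * n` rounds costs each unfinished class at most `s` letters, so
classes of size `s * K * n` suffice (`exists_monochromatic_blocks`). Thinning a class later on does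
no harm to the intervals found before, provided all classes of one level keep equal sizes; the
number `n` of parts per class guarantees this (`exists_refinement_chain`). In the first permutation
the blocks are single letters. With `t = p - 2` this needs `n ^ (t ^ 2 + 1) * k ^ (t + 1)` letters,
which is at most the number available. A permutation of `B` along which the class labels increase
is the concatenation of its classes (`flatten_ofFn_filter_eq`), so that classes of size `n ^ i` are
the blocks of the statement.
-/

namespace WordComb

/-! ### Words that induce permutations -/

/-- The letters of `B` occur in `w`, and no two of them interleave there: between two occurrences
of a letter of `B` there is no other letter of `B`. -/
def Separates {A : Type*} (B : Finset A) (w : List A) : Prop :=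
  (∀ a ∈ B, a ∈ w) ∧ ∀ a ∈ B, ∀ b ∈ B, a ≠ b → ¬ [a, b, a].Sublist w

lemma Separates.mono {A : Type*} {B C : Finset A} {w : List A} (h : Separates B w) (hC : C ⊆ B) :
    Separates C w :=
  ⟨fun a ha => h.1 a (hC ha), fun a ha b hb => h.2 a (hC ha) b (hC hb)⟩

lemma sublist_destutter'_of_isChain {A : Type*} [DecidableEq A] (l : List A) :
    ∀ (c : A) (x : List A), x.IsChain (· ≠ ·) → x.Sublist (c :: l) →
      x.Sublist (l.destutter' (fun a b => a ≠ b) c) := by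
  induction l with
  | nil => intro c x _ h; simpa using h
  | cons d l ih =>
    intro c x hx h
    rw [List.destutter'_cons]
    split_ifs with hcd
    · cases h with
      | cons _ h => exact (ih d x hx h).cons c
      | cons_cons _ h => exact (ih d _ hx.tail h).cons_cons c
    · have hcd : c = d := not_not.mp hcd
      subst hcd
      refine ih c x hx ?_
      cases h with
      | cons _ h => exact h
      | @cons_cons x' _ _ h =>
        cases h with
        | cons _ h => exact h.cons_cons c
        | cons_cons _ h => simp at hx

/-- Every sublist without equal neighbours survives the removal of repetitions. -/
lemma sublist_destutter_of_isChain {A : Type*} [DecidableEq A] {l x : List A}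
    (hx : x.IsChain (· ≠ ·)) (h : x.Sublist l) :
    x.Sublist (l.destutter (fun a b => a ≠ b)) := by
  cases l with
  | nil => simpa using h
  | cons c l => exact sublist_destutter'_of_isChain l c x hx h

lemma exists_between_of_isChain_ne {A : Type*} {l : List A} (hl : l.IsChain (· ≠ ·)) {a : A}
    (h : [a, a].Sublist l) : ∃ b, b ≠ a ∧ [a, b, a].Sublist l := by
  induction l with
  | nil => simp at h
  | cons c l ih =>
    cases h with
    | cons _ h =>
      obtain ⟨b, hb, hs⟩ := ih hl.tail h
      exact ⟨b, hb, hs.cons c⟩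
    | cons_cons _ h =>
      cases l with
      | nil => simp at h
      | cons d l =>
        have had : a ≠ d := by
          simp only [List.isChain_cons_cons] at hl
          exact hl.1
        refine ⟨d, had.symm, ?_⟩
        have : a ∈ l := by
          have := List.singleton_sublist.mp h
          simpa [had] using this
        exact ((List.singleton_sublist.mpr this).cons_cons d).cons_cons a

lemma reduct_sublist {A : Type*} [DecidableEq A] (B : Finset A) (w : List A) :
    (reduct B w).Sublist w :=
  (List.destutter_sublist _ _).trans List.filter_sublist

lemma mem_of_mem_reduct {A : Type*} [DecidableEq A] {B : Finset A} {w : List A} {a : A}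
    (h : a ∈ reduct B w) : a ∈ B := by
  have := (List.destutter_sublist _ _).subset h
  simpa using (List.mem_filter.mp this).2

lemma sublist_reduct {A : Type*} [DecidableEq A] {B : Finset A} {w x : List A}
    (hx : x.IsChain (· ≠ ·)) (hB : ∀ a ∈ x, a ∈ B) (h : x.Sublist w) :
    x.Sublist (reduct B w) := by
  refine sublist_destutter_of_isChain hx ?_
  have := h.filter (fun a => decide (a ∈ B))
  rwa [List.filter_eq_self.mpr (by simpa using hB)] at this

lemma isPermutationOf_reduct_iff {A : Type*} [DecidableEq A] {B : Finset A} {w : List A} :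
    IsPermutationOf (reduct B w) B ↔ B.Nonempty ∧ Separates B w := by
  constructor
  · rintro ⟨hne, hB, hc⟩
    obtain ⟨a, ha⟩ := List.exists_mem_of_ne_nil _ hne
    refine ⟨⟨a, hB a ha⟩, fun b hb => ?_, fun b hb c hcB hbc hs => ?_⟩
    · refine (reduct_sublist B w).subset (List.count_pos_iff.mp ?_)
      rw [hc b hb]; exact one_pos
    · have h1 : [b, c, b].Sublist (reduct B w) :=
        sublist_reduct (by simp [hbc, hbc.symm]) (by simp [hb, hcB]) hs
      have := h1.count_le b
      rw [hc b hb] at this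
      simp [hbc.symm] at this
  · rintro ⟨⟨a, ha⟩, hw, hs⟩
    have hmem : ∀ b ∈ B, b ∈ reduct B w := fun b hb =>
      List.singleton_sublist.mp
        (sublist_reduct (by simp) (by simpa using hb) (List.singleton_sublist.mpr (hw b hb)))
    refine ⟨List.ne_nil_of_mem (hmem a ha), fun b hb => mem_of_mem_reduct hb, fun b hb => ?_⟩
    refine le_antisymm ?_ (List.count_pos_iff.mpr (hmem b hb))
    by_contra! hlt
    have h2 : [b, b].Sublist (reduct B w) :=
      List.replicate_sublist_iff.mpr (show 2 ≤ _ from hlt)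
    obtain ⟨c, hcb, h3⟩ := exists_between_of_isChain_ne (List.isChain_destutter _ _) h2
    exact hs b hb c (mem_of_mem_reduct (h3.subset (by simp))) hcb.symm
      (h3.trans (reduct_sublist B w))

lemma IsPermutationOf.nodup {A : Type*} [DecidableEq A] {B : Finset A} {l : List A}
    (h : IsPermutationOf l B) : l.Nodup :=
  List.nodup_iff_count_le_one.mpr fun a => by
    by_cases ha : a ∈ l
    · exact (h.2.2 a (h.2.1 a ha)).le
    · simp [List.count_eq_zero_of_not_mem ha]

lemma IsPermutationOf.toFinset_eq {A : Type*} [DecidableEq A] {B : Finset A} {l : List A}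
    (h : IsPermutationOf l B) : l.toFinset = B := by
  ext a
  rw [List.mem_toFinset]
  refine ⟨h.2.1 a, fun ha => List.count_pos_iff.mp ?_⟩
  rw [h.2.2 a ha]; exact one_pos

lemma reduct_eq_filter_reduct {A : Type*} [DecidableEq A] {B C : Finset A} {w : List A}
    (h : IsPermutationOf (reduct B w) B) (hC : C ⊆ B) (hne : C.Nonempty) :
    reduct C w = (reduct B w).filter (· ∈ C) := by
  have hCp : IsPermutationOf (reduct C w) C :=
    isPermutationOf_reduct_iff.mpr ⟨hne, (isPermutationOf_reduct_iff.mp h).2.mono hC⟩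
  have hnd : ((reduct B w).filter (· ∈ C)).Nodup := h.nodup.filter _
  have hsub : ((reduct B w).filter (· ∈ C)).Sublist (reduct C w) :=
    sublist_reduct hnd.isChain (fun a ha => by simpa using (List.mem_filter.mp ha).2)
      (List.filter_sublist.trans (reduct_sublist B w))
  refine (hsub.eq_of_length ?_).symm
  rw [← List.toFinset_card_of_nodup hnd, ← List.toFinset_card_of_nodup hCp.nodup,
    hCp.toFinset_eq, List.toFinset_filter, h.toFinset_eq]
  congr 1
  ext a
  simpa using @hC a

/-- Among many letters of a word either many straddle a common cut, or many occupy pairwise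
disjoint intervals. -/
lemma exists_cut_or_separates {A : Type*} [DecidableEq A] (s m : ℕ) :
    ∀ (α : List A) (B : Finset A), (∀ a ∈ B, a ∈ α) → s * m ≤ B.card →
      (∃ β γ, α = β ++ γ ∧ s ≤ (B.filter (fun a => a ∈ β ∧ a ∈ γ)).card) ∨
      ∃ C ⊆ B, C.card = m ∧ Separates C α := by
  induction m with
  | zero => exact fun α B _ _ => Or.inr ⟨∅, by simp, by simp, by simp [Separates]⟩
  | succ m ih =>
    intro α B hB hcard
    rcases Nat.eq_zero_or_pos s with rfl | hs
    · exact Or.inl ⟨[], α, by simp, by simp⟩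
    have hBne : B.Nonempty := Finset.card_pos.mp (by nlinarith)
    -- the shortest prefix after which some letter of `B` is exhausted
    have hex : ∃ i, ∃ a ∈ B, a ∉ α.drop i :=
      ⟨α.length, hBne.choose, hBne.choose_spec, by simp⟩
    classical
    obtain ⟨x, hxB, hx⟩ := Nat.find_spec hex
    have hmin := fun j => Nat.find_min (m := j) hex
    generalize Nat.find hex = i at hx hmin
    obtain _ | i := i
    · exact absurd (hB x hxB) hx
    have hprev : ∀ a ∈ B, a ∈ α.drop i := by
      intro a ha
      by_contra hcon
      exact hmin i (Nat.lt_succ_self i) ⟨a, ha, hcon⟩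
    have hi : i < α.length := by
      have := List.length_pos_of_mem (hprev x hxB)
      rw [List.length_drop] at this
      omega
    have hdrop : α.drop i = α[i] :: α.drop (i + 1) := List.drop_eq_getElem_cons hi
    have honly : ∀ a ∈ B, a ∉ α.drop (i + 1) → a = x := by
      have key : ∀ a ∈ B, a ∉ α.drop (i + 1) → a = α[i] := by
        intro a ha hna
        have := hprev a ha
        rw [hdrop] at this
        exact (List.mem_cons.mp this).resolve_right hna
      intro a ha hna
      rw [key a ha hna, key x hxB hx]
    set β := α.take (i + 1) with hβ
    set γ := α.drop (i + 1) with hγ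
    have hα : α = β ++ γ := (List.take_append_drop _ _).symm
    by_cases hcross : s ≤ (B.filter (fun a => a ∈ β ∧ a ∈ γ)).card
    · exact Or.inl ⟨β, γ, hα, hcross⟩
    push Not at hcross
    have hxβ : x ∈ β := by
      have := hB x hxB
      rw [hα, List.mem_append] at this
      tauto
    have hB' : s * m ≤ (B.filter (· ∉ β)).card := by
      have hcover : B ⊆ B.filter (· ∉ β) ∪ (B.filter (fun a => a ∈ β ∧ a ∈ γ) ∪ {x}) := by
        intro a ha
        have := honly a ha
        simp only [Finset.mem_union, Finset.mem_filter, Finset.mem_singleton]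
        tauto
      have h1 := Finset.card_le_card hcover
      have h2 := Finset.card_union_le (B.filter (· ∉ β))
        (B.filter (fun a => a ∈ β ∧ a ∈ γ) ∪ {x})
      have h3 := Finset.card_union_le (B.filter (fun a => a ∈ β ∧ a ∈ γ)) {x}
      rw [Finset.card_singleton] at h3
      rw [Nat.mul_succ] at hcard
      omega
    have hB'γ : ∀ a ∈ B.filter (· ∉ β), a ∈ γ := by
      intro a ha
      rw [Finset.mem_filter] at ha
      have := hB a ha.1
      rw [hα, List.mem_append] at this
      tauto
    rcases ih γ (B.filter (· ∉ β)) hB'γ hB' with ⟨β', γ', hγ', hc⟩ | ⟨C, hCB, hCm, hCs⟩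
    · left
      refine ⟨β ++ β', γ', by rw [List.append_assoc, ← hγ', ← hα], hc.trans ?_⟩
      refine Finset.card_le_card fun a ha => ?_
      simp only [Finset.mem_filter, List.mem_append] at ha ⊢
      tauto
    · right
      have hCβ : ∀ a ∈ C, a ∉ β := fun a ha => (Finset.mem_filter.mp (hCB ha)).2
      have hxC : x ∉ C := fun h => hCβ x h hxβ
      refine ⟨insert x C, ?_, by rw [Finset.card_insert_of_notMem hxC, hCm], ?_, ?_⟩
      · exact Finset.insert_subset hxB (hCB.trans (Finset.filter_subset _ _))
      · intro a ha
        rw [hα, List.mem_append]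
        rcases Finset.mem_insert.mp ha with rfl | ha
        · exact Or.inl hxβ
        · exact Or.inr (hCs.1 a ha)
      · intro a ha b hb hab hsub
        rw [hα, List.sublist_append_iff] at hsub
        obtain ⟨u, v, huv, hu, hv⟩ := hsub
        have hab' : a ∉ β ∨ a ∉ γ := by
          rcases Finset.mem_insert.mp ha with rfl | ha
          · exact Or.inr hx
          · exact Or.inl (hCβ a ha)
        have haC : a ∈ C → a ∉ β := hCβ a
        have hbC : b ∈ C → b ∉ β := hCβ b
        rw [Finset.mem_insert] at ha hb
        rcases u with _ | ⟨u1, u⟩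
        · simp only [List.nil_append] at huv
          subst huv
          have haγ : a ∈ γ := hv.subset (by simp)
          have hbγ : b ∈ γ := hv.subset (by simp)
          have haC : a ∈ C := ha.resolve_left (by rintro rfl; exact hx haγ)
          have hbC : b ∈ C := hb.resolve_left (by rintro rfl; exact hx hbγ)
          exact hCs.2 a haC b hbC hab hv
        · have hau : u1 = a := by simp at huv; exact huv.1.symm
          subst hau
          have haβ : u1 ∈ β := hu.subset (by simp)
          have hax : u1 = x := ha.resolve_right fun h => haC h haβ
          have hbC' : b ∈ C := hb.resolve_left fun h => hab (hax.trans h.symm)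
          rcases List.eq_nil_or_concat v with rfl | ⟨v', y, rfl⟩
          · rw [List.append_nil] at huv
            exact hbC hbC' (hu.subset (by rw [← huv]; simp))
          · have : y = u1 := by
              have := congrArg List.getLast? huv
              simp only [← List.append_assoc, List.concat_eq_append, List.getLast?_append] at this
              simpa using this.symm
            subst this
            exact hx (hax ▸ hv.subset (by simp))

/-- For every `m` and every bound `Q` there is an `M` that forces `m` letters whose occurrences
split into at most `q` separated rounds, simultaneously for all multiplicities `q ≤ Q`. -/
lemma exists_forcing (Q : ℕ) : ∀ m : ℕ, ∃ M : ℕ, ∀ q, q ≤ Q →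
    ∀ {A : Type} [DecidableEq A] (α : List A) (B : Finset A), M ≤ B.card → (∀ a ∈ B, a ∈ α) →
      (∀ a ∈ B, α.count a ≤ q) → 1 ≤ q →
      ∃ C ⊆ B, C.card = m ∧ ∃ L : List (List A), α = L.flatten ∧ 1 ≤ L.length ∧ L.length ≤ q ∧
        ∀ w ∈ L, Separates C w := by
  induction Q with
  | zero => exact fun m => ⟨0, fun q hq A _ α B _ _ _ hq1 => by omega⟩
  | succ Q ih =>
    intro m
    obtain ⟨M₁, h₁⟩ := ih m
    obtain ⟨M₂, h₂⟩ := ih M₁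
    refine ⟨(Q + 1) * (M₂ + 1) * m, fun q hq A _ α B hM hB hc hq1 => ?_⟩
    rcases exists_cut_or_separates ((Q + 1) * (M₂ + 1)) m α B hB hM with
      ⟨β, γ, rfl, hcut⟩ | ⟨C, hCB, hCm, hC⟩
    swap
    · exact ⟨C, hCB, hCm, [α], by simp, by simp, by simpa using hq1, by simpa using hC⟩
    -- choose many straddling letters with the same number of occurrences left of the cut
    set X := B.filter (fun a => a ∈ β ∧ a ∈ γ) with hX
    have hXp : ∀ a ∈ X, 1 ≤ β.count a ∧ 1 ≤ γ.count a ∧ β.count a + γ.count a ≤ q := by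
      intro a ha
      rw [hX, Finset.mem_filter] at ha
      refine ⟨List.count_pos_iff.mpr ha.2.1, List.count_pos_iff.mpr ha.2.2, ?_⟩
      rw [← List.count_append]
      exact hc a ha.1
    obtain ⟨c, -, hcX⟩ := Finset.exists_le_card_fiber_of_mul_le_card_of_maps_to
      (s := X) (t := Finset.range (Q + 1)) (f := fun a => β.count a) (n := M₂ + 1)
      (fun a ha => by have := hXp a ha; simp only [Finset.mem_range]; omega)
      ⟨0, by simp⟩ (by simpa using hcut)
    obtain ⟨a₀, ha₀⟩ := Finset.card_pos.mp ((Nat.succ_pos M₂).trans_le hcX)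
    rw [Finset.mem_filter] at ha₀
    have hc₀ := hXp a₀ ha₀.1
    rw [ha₀.2] at hc₀
    obtain ⟨C₁, hC₁X, hC₁m, L₁, hβ, -, hL₁, hs₁⟩ := h₂ c (by omega) β
      (X.filter (fun a => β.count a = c)) ((Nat.le_succ M₂).trans hcX)
      (fun a ha => (Finset.mem_filter.mp (Finset.mem_filter.mp ha).1).2.1)
      (fun a ha => (Finset.mem_filter.mp ha).2.le) hc₀.1
    obtain ⟨C₂, hC₂C, hC₂m, L₂, hγ, hL₂', hL₂, hs₂⟩ := h₁ (q - c) (by omega) γ C₁ hC₁m.ge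
      (fun a ha => (Finset.mem_filter.mp (Finset.mem_filter.mp (hC₁X ha)).1).2.2)
      (fun a ha => by
        have h := Finset.mem_filter.mp (hC₁X ha)
        have := hXp a h.1
        omega) (by omega)
    refine ⟨C₂, fun a ha => ?_, hC₂m, L₁ ++ L₂, by rw [List.flatten_append, ← hβ, ← hγ],
      by rw [List.length_append]; omega, by rw [List.length_append]; omega, ?_⟩
    · exact (Finset.mem_filter.mp (Finset.mem_filter.mp (hC₁X (hC₂C ha))).1).1
    · intro w hw
      rcases List.mem_append.mp hw with hw | hw
      · exact (hs₁ w hw).mono hC₂C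
      · exact hs₂ w hw

/-! ### The number `N` and arbitrary alphabets -/

lemma forcesPermutations_N {m q : ℕ} (hm : 1 ≤ m) (hq : 1 ≤ q) :
    ForcesPermutations m q (N m q) := by
  have hne : {M : ℕ | 0 < M ∧ ForcesPermutations m q M}.Nonempty := by
    obtain ⟨M, hM⟩ := exists_forcing q m
    refine ⟨M + 1, Nat.succ_pos M, fun α hα hc => ?_⟩
    obtain ⟨C, hC, hCm, L, hL, h1, h2, hs⟩ := hM q le_rfl α (alph α) (by omega)
      (fun a ha => List.mem_toFinset.mp ha) hc hq
    refine ⟨C, hC, hCm, L.length, h1, h2, L.get, ?_, fun i => ?_⟩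
    · rw [IsFactorization, List.ofFn_get, ← hL]
    · exact isPermutationOf_reduct_iff.mpr ⟨Finset.card_pos.mp (by omega), hs _ (L.get_mem i)⟩
  exact (Nat.sInf_mem hne).2

lemma exists_eq_flatten_of_map_eq_flatten {A B : Type*} (f : A → B) :
    ∀ (L : List (List B)) (α : List A), α.map f = L.flatten →
      ∃ L' : List (List A), L'.map (List.map f) = L ∧ α = L'.flatten := by
  intro L
  induction L with
  | nil => intro α h; exact ⟨[], rfl, by simpa using h⟩
  | cons w L ih =>
    intro α h
    rw [List.flatten_cons, List.map_eq_append_iff] at h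
    obtain ⟨x, y, rfl, rfl, hy⟩ := h
    obtain ⟨L', rfl, rfl⟩ := ih y hy
    exact ⟨x :: L', rfl, rfl⟩

/-- The property that defines `N` for words over `ℕ` holds over every alphabet: the letters of a
word are renamed by the position of their first occurrence. -/
lemma ForcesPermutations.of_word {A : Type*} [DecidableEq A] {m q M : ℕ}
    (h : ForcesPermutations m q M) (α : List A) (hM : M ≤ (alph α).card)
    (hc : ∀ a ∈ alph α, α.count a ≤ q) :
    ∃ B : Finset A, B ⊆ alph α ∧ B.card = m ∧
      ∃ p : ℕ, 1 ≤ p ∧ p ≤ q ∧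
        ∃ w : Fin p → List A, IsFactorization α w ∧
          ∀ i, IsPermutationOf (reduct B (w i)) B := by
  set f : A → ℕ := fun a => α.idxOf a with hf
  have hinj : Set.InjOn f (alph α) := fun a ha b _ hab =>
    (List.idxOf_inj (List.mem_toFinset.mp ha)).mp hab
  have halph : alph (α.map f) = (alph α).image f := by
    ext; simp [alph]
  obtain ⟨B, hB, hBm, p, hp1, hpq, w, hw, hperm⟩ := h (α.map f)
    (by rwa [halph, Finset.card_image_of_injOn hinj]) (by
      intro b hb
      rw [halph, Finset.mem_image] at hb
      obtain ⟨a, ha, rfl⟩ := hb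
      refine le_trans (le_of_eq ?_) (hc a ha)
      rw [List.count, List.countP_map, List.count]
      refine List.countP_congr fun x hx => ?_
      simp only [Function.comp, beq_iff_eq]
      exact ⟨fun h => hinj (List.mem_toFinset.mpr hx) ha h, fun h => by rw [h]⟩)
  obtain ⟨L, hL, hα⟩ := exists_eq_flatten_of_map_eq_flatten f _ α hw
  have hlen : L.length = p := by
    have := congrArg List.length hL
    simpa using this
  subst hlen
  have hwi : ∀ i : Fin L.length, w i = (L.get i).map f := by
    intro i
    have : (L.map (List.map f))[i.1]'(by simp) = (List.ofFn w)[i.1]'(by simp) := by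
      simp only [hL]
    simpa using this.symm
  set B' := (alph α).filter (fun a => f a ∈ B) with hB'
  have himg : B'.image f = B := by
    ext b
    simp only [hB', Finset.mem_image, Finset.mem_filter]
    constructor
    · rintro ⟨a, ⟨-, ha⟩, rfl⟩; exact ha
    · intro hb
      have := hB hb
      rw [halph, Finset.mem_image] at this
      obtain ⟨a, ha, rfl⟩ := this
      exact ⟨a, ⟨ha, hb⟩, rfl⟩
  have hinj' : Set.InjOn f B' := hinj.mono (Finset.coe_subset.mpr (Finset.filter_subset _ _))
  refine ⟨B', Finset.filter_subset _ _, ?_, L.length, hp1, hpq, L.get, ?_, fun i => ?_⟩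
  · rw [← hBm, ← himg, Finset.card_image_of_injOn hinj']
  · rw [IsFactorization, List.ofFn_get, ← hα]
  · obtain ⟨hne, hmem, hsep⟩ := isPermutationOf_reduct_iff.mp (hperm i)
    rw [hwi i] at hmem hsep
    refine isPermutationOf_reduct_iff.mpr ⟨?_, fun a ha => ?_, fun a ha b hb hab hs => ?_⟩
    · rw [← himg] at hne
      exact Finset.image_nonempty.mp hne
    · have hfa := hmem (f a) (Finset.mem_filter.mp ha).2
      obtain ⟨a', ha', hfa'⟩ := List.mem_map.mp hfa
      have haα : a' ∈ alph α := by
        rw [alph, hα, List.mem_toFinset]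
        exact List.mem_flatten.mpr ⟨_, L.get_mem i, ha'⟩
      rwa [← hinj haα (Finset.mem_filter.mp ha).1 hfa']
    · exact hsep (f a) (Finset.mem_filter.mp ha).2 (f b) (Finset.mem_filter.mp hb).2
        (fun h => hab (hinj' ha hb h)) (hs.map f)

/-! ### Greedy thinning along permutations -/

/-- The shortest prefix in which some colour `j` with `P j` reaches `s` occurrences: it has exactly
`s` letters of that colour, and at most `s` of every other colour satisfying `P`. -/
lemma exists_prefix_countP {A : Type*} (s : ℕ) (c : A → ℕ) (P : ℕ → Prop) (l : List A)
    (h : ∃ j, P j ∧ s ≤ l.countP (c · = j)) :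
    ∃ x y, l = x ++ y ∧ (∃ j, P j ∧ x.countP (c · = j) = s) ∧
      ∀ j, P j → x.countP (c · = j) ≤ s := by
  have hex : ∃ i, ∃ j, P j ∧ s ≤ (l.take i).countP (c · = j) := by
    obtain ⟨j, hj, hs⟩ := h
    exact ⟨l.length, j, hj, by rwa [List.take_length]⟩
  classical
  obtain ⟨j, hj, hs⟩ := Nat.find_spec hex
  have hmin := fun i => Nat.find_min (m := i) hex
  generalize Nat.find hex = i at hs hmin
  have hle : ∀ j, P j → (l.take i).countP (c · = j) ≤ s := by
    intro j hj
    obtain _ | i := i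
    · simp
    have hlt : (l.take i).countP (c · = j) < s := by
      by_contra! hcon
      exact hmin i (Nat.lt_succ_self i) ⟨j, hj, hcon⟩
    rw [List.take_add_one, List.countP_append]
    have : (l[i]?.toList).countP (c · = j) ≤ 1 :=
      List.countP_le_length.trans (by cases l[i]? <;> simp)
    omega
  exact ⟨l.take i, l.drop i, (List.take_append_drop _ _).symm, ⟨j, hj, le_antisymm (hle j hj) hs⟩,
    hle⟩

/-- Greedy cutting. If every colour `j` with a positive demand `r j` is frequent enough in the word
`l`, then `l` has a sublist that is a concatenation of `R = ∑ r j` monochromatic blocks of length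
`s`, exactly `r j` of them of colour `j`. The block of a letter `a` has number `c' a`, and `g` gives
the colour of a block. -/
lemma exists_monochromatic_blocks {A : Type*} [DecidableEq A] (s K : ℕ) (c : A → ℕ) (R : ℕ) :
    ∀ (r : ℕ → ℕ) (l : List A), l.Nodup → ∑ j ∈ Finset.range K, r j = R →
      (∀ j < K, 0 < r j → s * R ≤ l.countP (c · = j)) →
      ∃ l' : List A, l'.Sublist l ∧ ∃ (c' : A → ℕ) (g : ℕ → ℕ),
        l'.Pairwise (fun a b => c' a ≤ c' b) ∧ (∀ a ∈ l', c' a < R ∧ c a = g (c' a)) ∧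
        (∀ j < R, l'.countP (c' · = j) = s) ∧
        ∀ j < K, (List.range R).countP (g · = j) = r j := by
  induction R with
  | zero =>
    intro r l _ hr _
    refine ⟨[], List.nil_sublist _, fun _ => 0, fun _ => 0, by simp, by simp, by simp,
      fun j hj => ?_⟩
    have := Finset.sum_eq_zero_iff.mp hr j (Finset.mem_range.mpr hj)
    simp [this]
  | succ R ih =>
    intro r l hl hr hfreq
    have hex : ∃ j, (j < K ∧ 0 < r j) ∧ s ≤ l.countP (c · = j) := by
      have : ∑ j ∈ Finset.range K, r j ≠ 0 := by omega
      obtain ⟨j, hj, hrj⟩ := Finset.exists_ne_zero_of_sum_ne_zero this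
      rw [Finset.mem_range] at hj
      have h := hfreq j hj (Nat.pos_of_ne_zero hrj)
      exact ⟨j, ⟨hj, Nat.pos_of_ne_zero hrj⟩, le_trans (Nat.le_mul_of_pos_right s R.succ_pos) h⟩
    obtain ⟨x, y, rfl, ⟨j₀, ⟨hj₀K, hj₀r⟩, hj₀⟩, hle⟩ :=
      exists_prefix_countP s c (fun j => j < K ∧ 0 < r j) l hex
    have hnd := List.nodup_append'.mp hl
    obtain ⟨l', hl', c', g, hmono, hlab, hfib, hg⟩ := ih (Function.update r j₀ (r j₀ - 1)) y hnd.2.1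
      (by
        have hmem := Finset.mem_range.mpr hj₀K
        rw [← Finset.add_sum_erase _ _ hmem] at hr ⊢
        rw [Function.update_self, Finset.sum_congr rfl fun j hj =>
          Function.update_of_ne (Finset.ne_of_mem_erase hj) _ _]
        omega)
      (by
        intro j hj hrj
        have hrj' : 0 < r j := by
          by_cases h : j = j₀
          · rwa [h]
          · rwa [Function.update_of_ne h] at hrj
        have h1 := hfreq j hj hrj'
        have h2 := hle j ⟨hj, hrj'⟩
        rw [List.countP_append, Nat.mul_succ] at h1
        omega)
    set z := x.filter (c · = j₀) with hz
    have hzl : z.length = s := by rw [hz, ← List.countP_eq_length_filter, hj₀]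
    have hl'z : ∀ a ∈ l', a ∉ z := fun a ha haz =>
      hnd.2.2 (List.filter_sublist.subset haz) (hl'.subset ha)
    refine ⟨z ++ l', List.filter_sublist.append hl', fun a => if a ∈ z then 0 else c' a + 1,
      fun i => Nat.casesOn i j₀ g, ?_, ?_, ?_, ?_⟩
    · rw [List.pairwise_append]
      refine ⟨?_, ?_, ?_⟩
      · exact List.pairwise_of_forall_mem_list fun a ha b hb => by simp [ha, hb]
      · exact hmono.imp_of_mem fun {a b} ha hb h => by simp [hl'z a ha, hl'z b hb, h]
      · intro a ha b hb; simp [ha]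
    · intro a ha
      by_cases haz : a ∈ z
      · have hca := (List.mem_filter.mp haz).2
        simp only [haz, if_true]
        exact ⟨R.succ_pos, by simpa using hca⟩
      · have ha' := hlab a ((List.mem_append.mp ha).resolve_left haz)
        simp only [haz, if_false]
        exact ⟨by omega, ha'.2⟩
    · intro j hj
      rw [List.countP_append]
      obtain _ | j := j
      · have h1 : z.countP (fun a => decide ((if a ∈ z then 0 else c' a + 1) = 0)) = z.length :=
          List.countP_eq_length.mpr fun a ha => by simp [ha]
        have h2 : l'.countP (fun a => decide ((if a ∈ z then 0 else c' a + 1) = 0)) = 0 :=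
          List.countP_eq_zero.mpr fun a ha => by simp [hl'z a ha]
        rw [h1, h2, hzl, add_zero]
      · have h1 : z.countP (fun a => decide ((if a ∈ z then 0 else c' a + 1) = j + 1)) = 0 :=
          List.countP_eq_zero.mpr fun a ha => by simp [ha]
        have h2 : l'.countP (fun a => decide ((if a ∈ z then 0 else c' a + 1) = j + 1)) =
            l'.countP (c' · = j) :=
          List.countP_congr fun a ha => by simp [hl'z a ha]
        rw [h1, h2, zero_add, hfib j (by omega)]
    · intro j hj
      have h := hg j hj
      rw [List.range_succ_eq_map, List.countP_cons, List.countP_map]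
      change (List.range R).countP (g · = j) + _ = _
      rw [h]
      by_cases hjj : j = j₀
      · subst hjj
        simp only [Function.update_self]
        change r j - 1 + (if decide (j = j) = true then 1 else 0) = r j
        simp only [decide_true, if_true]
        omega
      · change Function.update r j₀ (r j₀ - 1) j + (if decide (j₀ = j) = true then 1 else 0) = r j
        simp [Function.update_of_ne hjj, Ne.symm hjj]

lemma filter_mem_toFinset_of_sublist {A : Type*} [DecidableEq A] {l l' : List A} (hl : l.Nodup)
    (h : l'.Sublist l) : l.filter (· ∈ l'.toFinset) = l' := by
  have h1 : l'.Sublist (l.filter (· ∈ l'.toFinset)) := by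
    have := h.filter (fun a => decide (a ∈ l'.toFinset))
    rwa [List.filter_eq_self.mpr (by simp)] at this
  refine (h1.eq_of_length ?_).symm
  rw [← List.toFinset_card_of_nodup (hl.filter _), ← List.toFinset_card_of_nodup (hl.sublist h)]
  congr 1
  ext a
  simpa using fun ha => h.subset ha

lemma countP_eq_card_filter {A : Type*} [DecidableEq A] {l : List A} (hl : l.Nodup)
    (P : A → Prop) [DecidablePred P] :
    l.countP (fun a => P a) = (l.toFinset.filter P).card := by
  rw [List.countP_eq_length_filter, ← List.toFinset_card_of_nodup (hl.filter _),
    List.toFinset_filter]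
  simp

/-- Greedy cutting along a permutation `l` of a superset of `B`: if the `K` classes of `c` on `B`
are large, then they can be thinned so that each becomes the union of `d` classes of a finer
labelling `c'`, all of size `s`, which are intervals of `l` numbered from left to right. -/
lemma exists_refinement {A : Type*} [DecidableEq A] (s d K : ℕ) (l : List A) (hl : l.Nodup)
    (B : Finset A) (hB : ∀ a ∈ B, a ∈ l) (c : A → ℕ)
    (hcard : ∀ j < K, s * (K * d) ≤ (B.filter (c · = j)).card) :
    ∃ C ⊆ B, ∃ (c' : A → ℕ) (g : ℕ → ℕ),
      (l.filter (· ∈ C)).Pairwise (fun a b => c' a ≤ c' b) ∧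
      (∀ a ∈ C, c' a < K * d ∧ c a = g (c' a)) ∧
      (∀ j < K * d, (C.filter (c' · = j)).card = s) ∧
      ∀ j < K, ((Finset.range (K * d)).filter (g · = j)).card = d := by
  have hnd : (l.filter (· ∈ B)).Nodup := hl.filter _
  have hfin : (l.filter (· ∈ B)).toFinset = B := by
    ext a
    simpa using hB a
  obtain ⟨l', hl', c', g, hmono, hlab, hfib, hg⟩ :=
    exists_monochromatic_blocks s K c (K * d) (fun _ => d) (l.filter (· ∈ B)) hnd (by simp)
      (fun j hj _ => by rw [countP_eq_card_filter hnd, hfin]; exact hcard j hj)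
  refine ⟨l'.toFinset, fun a ha => ?_, c', g, ?_, ?_, ?_, ?_⟩
  · rw [← hfin, List.mem_toFinset]
    exact hl'.subset (List.mem_toFinset.mp ha)
  · rwa [filter_mem_toFinset_of_sublist hl (hl'.trans List.filter_sublist)]
  · exact fun a ha => hlab a (List.mem_toFinset.mp ha)
  · intro j hj
    rw [← countP_eq_card_filter (hnd.sublist hl'), hfib j hj]
  · intro j hj
    have := hg j hj
    rw [countP_eq_card_filter List.nodup_range, List.toFinset_range] at this
    exact this

/-- Iterated thinning along permutations `ρ 0, ρ 1, …, ρ (t - 1)`: the labellings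
`C 0 = c, C 1, …, C t` refine each other, each class splits into `n` classes of the next one, and
the classes of `C (i + 1)` are intervals of `ρ i`. -/
lemma exists_refinement_chain {A : Type*} [DecidableEq A] (n s : ℕ) (hn : 1 ≤ n) (t : ℕ) :
    ∀ (K : ℕ) (ρ : ℕ → List A) (B : Finset A) (c : A → ℕ), (∀ i < t, (ρ i).Nodup) →
      (∀ i < t, ∀ a ∈ B, a ∈ ρ i) → (∀ a ∈ B, c a < K) →
      (∀ j < K, s * n ^ (t ^ 2) * K ^ t ≤ (B.filter (c · = j)).card) →
      ∃ B' ⊆ B, ∃ C : ℕ → A → ℕ, C 0 = c ∧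
        (∀ i ≤ t, ∀ a ∈ B', C i a < K * n ^ i) ∧
        (∀ i ≤ t, ∀ j < K * n ^ i, (B'.filter (C i · = j)).card = n ^ (t - i) * s) ∧
        (∀ i < t, ((ρ i).filter (· ∈ B')).Pairwise (fun a b => C (i + 1) a ≤ C (i + 1) b)) ∧
        ∀ i < t, ∀ a ∈ B', ∀ b ∈ B', C (i + 1) a = C (i + 1) b → C i a = C i b := by
  induction t with
  | zero =>
    intro K ρ B c _ _ hcK hcard
    have hT : ∀ j, ∃ T ⊆ B.filter (c · = j), j < K → T.card = s := by
      intro j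
      by_cases hj : j < K
      · obtain ⟨T, hT, hTs⟩ := Finset.exists_subset_card_eq (by simpa using hcard j hj)
        exact ⟨T, hT, fun _ => hTs⟩
      · exact ⟨∅, by simp, fun h => absurd h hj⟩
    choose T hTB hTs using hT
    have hB' : ∀ a ∈ (Finset.range K).biUnion T, a ∈ B ∧ a ∈ T (c a) := by
      intro a ha
      obtain ⟨j, -, hj⟩ := Finset.mem_biUnion.mp ha
      have := Finset.mem_filter.mp (hTB j hj)
      exact ⟨this.1, by rwa [this.2]⟩
    refine ⟨(Finset.range K).biUnion T, fun a ha => (hB' a ha).1, fun _ => c, rfl, ?_, ?_,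
      by simp, by simp⟩
    · intro i hi a ha
      obtain rfl := Nat.le_zero.mp hi
      simpa using hcK a (hB' a ha).1
    · intro i hi j hj
      obtain rfl := Nat.le_zero.mp hi
      have hj : j < K := by simpa using hj
      have : ((Finset.range K).biUnion T).filter (c · = j) = T j := by
        ext a
        rw [Finset.mem_filter]
        constructor
        · rintro ⟨ha, rfl⟩; exact (hB' a ha).2
        · intro ha
          exact ⟨Finset.mem_biUnion.mpr ⟨j, Finset.mem_range.mpr hj, ha⟩,
            (Finset.mem_filter.mp (hTB j ha)).2⟩
      rw [this, hTs j hj]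
      simp
  | succ t ih =>
    intro K ρ B c hnd hmem hcK hcard
    obtain ⟨B₁, hB₁, c₁, g, hmono, hlab, hfib, hg⟩ :=
      exists_refinement (s * n ^ (t ^ 2) * (K * n) ^ t) n K (ρ 0) (hnd 0 t.succ_pos) B
        (hmem 0 t.succ_pos) c (fun j hj => le_trans (by
          calc s * n ^ (t ^ 2) * (K * n) ^ t * (K * n)
              = s * n ^ (t ^ 2 + t + 1) * K ^ (t + 1) := by ring
            _ ≤ s * n ^ ((t + 1) ^ 2) * K ^ (t + 1) := by
                gcongr
                nlinarith) (hcard j hj))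
    obtain ⟨B', hB', C, hC0, hlt, hcardC, hmonoC, href⟩ := ih (K * n) (fun i => ρ (i + 1)) B₁ c₁
      (fun i hi => hnd (i + 1) (by omega))
      (fun i hi a ha => hmem (i + 1) (by omega) a (hB₁ ha))
      (fun a ha => (hlab a ha).1) (fun j hj => (hfib j hj).ge)
    refine ⟨B', hB'.trans hB₁, fun i => Nat.casesOn i c C, rfl, ?_, ?_, ?_, ?_⟩
    · rintro (_ | i) hi a ha
      · simpa using hcK a (hB₁ (hB' ha))
      · have := hlt i (by omega) a ha
        rwa [mul_assoc, ← pow_succ'] at this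
    · rintro (_ | i) hi j hj
      · have hj : j < K := by simpa using hj
        change (B'.filter (c · = j)).card = _
        -- the class `j` of `c` is the union of the `n` classes of `c₁` that `g` maps to `j`
        rw [Finset.card_eq_sum_card_fiberwise (f := c₁)
          (t := (Finset.range (K * n)).filter (g · = j))]
        · rw [Finset.sum_congr rfl (g := fun _ => n ^ t * s), Finset.sum_const, hg j hj]
          · rw [smul_eq_mul, Nat.sub_zero, pow_succ]; ring
          · intro i hi
            obtain ⟨hi, hgi⟩ := Finset.mem_filter.mp hi
            have h := hcardC 0 (Nat.zero_le _) i (by simpa using hi)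
            rw [hC0, Nat.sub_zero] at h
            rw [← h, Finset.filter_filter]
            congr 1
            refine Finset.filter_congr fun a ha => ⟨fun h => h.2, fun h => ⟨?_, h⟩⟩
            rw [(hlab a (hB' ha)).2, h, hgi]
        · intro a ha
          obtain ⟨ha, haj⟩ := Finset.mem_filter.mp (Finset.mem_coe.mp ha)
          have := hlab a (hB' ha)
          rw [Finset.mem_coe, Finset.mem_filter, Finset.mem_range]
          exact ⟨this.1, by rw [← this.2, haj]⟩
      · have := hcardC i (by omega) j (by rwa [mul_assoc, ← pow_succ'])
        rwa [Nat.add_sub_add_right]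
    · rintro (_ | i) hi
      · have hsub : ((ρ 0).filter (· ∈ B')).Sublist ((ρ 0).filter (· ∈ B₁)) :=
          List.monotone_filter_right _ fun a ha => by simpa using hB' (by simpa using ha)
        change List.Pairwise (fun a b => C 0 a ≤ C 0 b) _
        rw [hC0]
        exact hmono.sublist hsub
      · exact hmonoC i (by omega)
    · rintro (_ | i) hi a ha b hb hab
      · change C 0 a = C 0 b at hab
        rw [hC0] at hab
        change c a = c b
        rw [(hlab a (hB' ha)).2, (hlab b (hB' hb)).2, hab]
      · exact href i (by omega) a ha b hb hab

/-! ### Nested blocks -/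

/-- A word along which the labels `D a < d` increase weakly is the concatenation of its label
classes. -/
lemma flatten_ofFn_filter_eq {A : Type*} (D : A → ℕ) (d : ℕ) :
    ∀ l : List A, l.Pairwise (fun a b => D a ≤ D b) → (∀ a ∈ l, D a < d) →
      l = (List.ofFn fun j : Fin d => l.filter (D · = j)).flatten := by
  induction d with
  | zero =>
    intro l _ h
    cases l with
    | nil => simp
    | cons a l => exact absurd (h a (by simp)) (Nat.not_lt_zero _)
  | succ d ih =>
    intro l hmono hlt
    have hsplit : l = l.filter (D · < d) ++ l.filter (D · = d) := by
      clear ih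
      induction l with
      | nil => rfl
      | cons a l ihl =>
        have ihl := ihl hmono.tail fun b hb => hlt b (List.mem_cons_of_mem _ hb)
        by_cases had : D a < d
        · rw [List.filter_cons_of_pos (by simpa using had),
            List.filter_cons_of_neg (by simpa using had.ne), List.cons_append, ← ihl]
        · have hall : ∀ b ∈ a :: l, D b = d := by
            intro b hb
            have h1 := hlt b hb
            have h2 : D a ≤ D b := by
              rcases List.mem_cons.mp hb with rfl | hb
              · exact le_rfl
              · exact (List.pairwise_cons.mp hmono).1 b hb
            omega
          rw [List.filter_eq_nil_iff.mpr fun b hb => by simp [hall b hb],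
            List.filter_eq_self.mpr fun b hb => by simp [hall b hb], List.nil_append]
    have hih := ih (l.filter (D · < d)) (hmono.filter _)
      fun a ha => by simpa using (List.mem_filter.mp ha).2
    rw [List.ofFn_succ_last, List.flatten_append]
    simp only [List.flatten_cons, List.flatten_nil, List.append_nil, Fin.val_castSucc,
      Fin.val_last]
    conv_lhs => rw [hsplit, hih]
    congr 3
    funext j
    rw [List.filter_filter]
    refine List.filter_congr fun a _ => ?_
    have := j.2
    by_cases h : D a = j <;> simp [h]

/-- If the label classes on `B` all have size `s`, and the labels increase weakly along the
permutation `l` of `B`, then the classes are the blocks of length `s` of `l`. -/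
lemma isBlockFactorization_filter {A : Type*} [DecidableEq A] {B : Finset A} {l : List A}
    (hl : IsPermutationOf l B) (D : A → ℕ) (d s : ℕ)
    (hmono : l.Pairwise (fun a b => D a ≤ D b)) (hlt : ∀ a ∈ B, D a < d)
    (hcard : ∀ j < d, (B.filter (D · = j)).card = s) :
    IsBlockFactorization l d s (fun j : Fin d => l.filter (D · = j)) := by
  refine ⟨flatten_ofFn_filter_eq D d l hmono fun a ha => hlt a (hl.2.1 a ha), fun j => ?_⟩
  rw [← List.countP_eq_length_filter, countP_eq_card_filter hl.nodup, hl.toFinset_eq,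
    hcard j j.2]

/-- From `t + 2` permutations of a large set `A₀` one extracts a subset `B` and labellings `D i` of
`B`, each refining the next, such that the classes of `D i` are `n ^ (t + 1 - i) * k` intervals of
`π i`, each with `n ^ i` letters of `B`. -/
lemma exists_nested_labels {A : Type*} [DecidableEq A] (n k t : ℕ) (hn : 1 ≤ n)
    (π : ℕ → List A) (A₀ : Finset A) (hπ : ∀ i < t + 2, IsPermutationOf (π i) A₀)
    (hcard : n ^ (t ^ 2 + 1) * k ^ (t + 1) ≤ A₀.card) :
    ∃ B ⊆ A₀, B.card = n ^ (t + 1) * k ∧ ∃ D : ℕ → A → ℕ,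
      (∀ i < t + 2, ∀ a ∈ B, D i a < n ^ (t + 1 - i) * k) ∧
      (∀ i < t + 2, ∀ j < n ^ (t + 1 - i) * k, (B.filter (D i · = j)).card = n ^ i) ∧
      (∀ i < t + 2, ((π i).filter (· ∈ B)).Pairwise (fun a b => D i a ≤ D i b)) ∧
      ∀ i < t + 1, ∀ a ∈ B, ∀ b ∈ B, D i a = D i b → D (i + 1) a = D (i + 1) b := by
  have hmem : ∀ i < t + 2, ∀ a ∈ A₀, a ∈ π i := fun i hi a ha =>
    List.count_pos_iff.mp (by rw [(hπ i hi).2.2 a ha]; exact one_pos)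
  -- cut the last permutation into `k` intervals, then go down to `π 1`
  obtain ⟨B₁, hB₁, c, _, hmono, hlab, hfib, -⟩ :=
    exists_refinement (n * n ^ (t ^ 2) * k ^ t) k 1 (π (t + 1)) (hπ _ (by omega)).nodup A₀
      (hmem _ (by omega)) (fun _ => 0) (by
        intro j hj
        obtain rfl : j = 0 := by omega
        rw [Finset.filter_true_of_mem (by simp)]
        refine le_trans (le_of_eq ?_) hcard
        ring)
  simp only [one_mul] at hlab hfib
  obtain ⟨B, hB, C, hC0, hlt, hcardC, hmonoC, href⟩ :=
    exists_refinement_chain n n hn t k (fun i => π (t - i)) B₁ c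
      (fun i _ => (hπ _ (by omega)).nodup) (fun i _ a ha => hmem _ (by omega) a (hB₁ ha))
      (fun a ha => (hlab a ha).1) (fun j hj => (hfib j hj).ge)
  have hBA : B ⊆ A₀ := hB.trans hB₁
  have hBcard : B.card = n ^ (t + 1) * k := by
    rw [Finset.card_eq_sum_card_fiberwise (f := c) (t := Finset.range k)
      (fun a ha => by simpa using (hlab a (hB ha)).1),
      Finset.sum_congr rfl (g := fun _ => n ^ t * n)]
    · rw [Finset.sum_const, Finset.card_range, smul_eq_mul, ← pow_succ, mul_comm]
    · intro j hj
      have := hcardC 0 (Nat.zero_le _) j (by simpa using hj)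
      rwa [hC0, Nat.sub_zero] at this
  -- the classes in `π 0` are single letters
  set l₀ := (π 0).filter (· ∈ B) with hl₀
  have hl₀nd : l₀.Nodup := (hπ 0 (by omega)).nodup.filter _
  have hl₀mem : ∀ a, a ∈ l₀ ↔ a ∈ B := fun a => by
    simpa [hl₀] using fun ha => hmem 0 (by omega) a (hBA ha)
  have hl₀len : l₀.length = B.card := by
    rw [← List.toFinset_card_of_nodup hl₀nd]
    congr 1
    ext a
    rw [List.mem_toFinset, hl₀mem]
  refine ⟨B, hBA, hBcard, fun i => Nat.casesOn i (fun a => l₀.idxOf a) fun i => C (t - i),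
    ?_, ?_, ?_, ?_⟩
  · rintro (_ | i) hi a ha
    · change l₀.idxOf a < _
      rw [Nat.sub_zero, ← hBcard, ← hl₀len]
      exact List.idxOf_lt_length_of_mem ((hl₀mem a).mpr ha)
    · have := hlt (t - i) (by omega) a ha
      rwa [Nat.add_sub_add_right, mul_comm]
  · rintro (_ | i) hi j hj
    · change (B.filter (l₀.idxOf · = j)).card = 1
      rw [Nat.sub_zero, ← hBcard, ← hl₀len] at hj
      rw [Finset.card_eq_one]
      refine ⟨l₀[j], ?_⟩
      ext a
      rw [Finset.mem_filter, Finset.mem_singleton]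
      constructor
      · rintro ⟨-, rfl⟩; simp
      · rintro rfl
        exact ⟨(hl₀mem _).mp (List.getElem_mem hj), hl₀nd.idxOf_getElem j hj⟩
    · rw [Nat.add_sub_add_right, mul_comm] at hj
      have := hcardC (t - i) (by omega) j hj
      rwa [Nat.sub_sub_self (by omega), ← pow_succ] at this
  · rintro (_ | i) hi
    · change l₀.Pairwise (fun a b => l₀.idxOf a ≤ l₀.idxOf b)
      rw [List.pairwise_iff_getElem]
      intro i j hi hj hij
      rw [hl₀nd.idxOf_getElem, hl₀nd.idxOf_getElem]
      exact hij.le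
    · change List.Pairwise (fun a b => C (t - i) a ≤ C (t - i) b) _
      rcases Nat.lt_or_ge i t with h | h
      · have := hmonoC (t - i - 1) (by omega)
        rwa [show t - (t - i - 1) = i + 1 by omega, show t - i - 1 + 1 = t - i by omega] at this
      · obtain rfl : i = t := by omega
        rw [Nat.sub_self, hC0]
        exact hmono.sublist (List.monotone_filter_right _
          fun a ha => by simpa using hB (by simpa using ha))
  · rintro (_ | i) hi a ha b hb hab
    · have : a = b := (List.idxOf_inj ((hl₀mem a).mpr ha)).mp hab
      rw [this]
    · have := href (t - (i + 1)) (by omega) a ha b hb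
      rw [show t - (i + 1) + 1 = t - i by omega] at this
      exact this hab

end WordComb

theorem theorem9 {A : Type*} [DecidableEq A] (α : List A) (k n q : ℕ)
    (hk : 2 ≤ k) (hn : 1 ≤ n) (hq : 2 ≤ q)
    (hcard : WordComb.N (n ^ ((q - 1) ^ 2) * k ^ (2 * q - 3)) q ≤ (WordComb.alph α).card)
    (hcount : ∀ a ∈ WordComb.alph α, α.count a ≤ q) :
    ∃ B : Finset A, B ⊆ WordComb.alph α ∧
      ∃ p : ℕ, 1 ≤ p ∧ p ≤ q ∧
        ∃ w : Fin p → List A, WordComb.IsFactorization α w ∧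
          B.card = n ^ (p - 1) * k ∧
          (∀ i : Fin p, B ⊆ WordComb.alph (w i) ∧
            WordComb.IsPermutationOf (WordComb.reduct B (w i)) B) ∧
          -- `i` counts from `0` here, so `w i` is the factor with number `i + 1`
          ∀ (i : ℕ) (hi : i + 1 < p),
            ∃ (z : Fin (n ^ (p - (i + 1)) * k) → List A)
              (u : Fin (n ^ (p - (i + 1) - 1) * k) → List A),
              WordComb.IsBlockFactorization
                (WordComb.reduct B (w ⟨i, Nat.lt_of_succ_lt hi⟩))
                (n ^ (p - (i + 1)) * k) (n ^ i) z ∧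
              WordComb.IsBlockFactorization
                (WordComb.reduct B (w ⟨i + 1, hi⟩))
                (n ^ (p - (i + 1) - 1) * k) (n ^ (i + 1)) u ∧
              ∀ j₁, ∃ j₂, WordComb.alph (z j₁) ⊆ WordComb.alph (u j₂) := by
  open WordComb in
  have hm : 1 ≤ n ^ ((q - 1) ^ 2) * k ^ (2 * q - 3) :=
    Nat.mul_pos (Nat.pow_pos hn) (Nat.pow_pos (by omega))
  obtain ⟨A₀, hA₀, hA₀m, p, hp1, hpq, w, hw, hperm⟩ :=
    (forcesPermutations_N hm (by omega)).of_word α hcard hcount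
  have hBprop : ∀ B ⊆ A₀, B.Nonempty → ∀ i : Fin p, B ⊆ alph (w i) ∧
      IsPermutationOf (reduct B (w i)) B := by
    intro B hB hne i
    have h := (isPermutationOf_reduct_iff.mp (hperm i)).2.mono hB
    exact ⟨fun a ha => List.mem_toFinset.mpr (h.1 a ha), isPermutationOf_reduct_iff.mpr ⟨hne, h⟩⟩
  rcases Nat.lt_or_ge p 2 with hp2 | hp2
  · obtain rfl : p = 1 := by omega
    have hkm : k ≤ A₀.card := by
      rw [hA₀m]
      calc k = 1 * k ^ 1 := by ring
        _ ≤ _ := Nat.mul_le_mul (Nat.one_le_pow _ _ hn) (Nat.pow_le_pow_right (by omega) (by omega))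
    obtain ⟨B, hB, hBk⟩ := Finset.exists_subset_card_eq hkm
    exact ⟨B, hB.trans hA₀, 1, le_rfl, hpq, w, hw, by simpa using hBk,
      hBprop B hB (Finset.card_pos.mp (by omega)), fun i hi => by omega⟩
  obtain ⟨t, rfl⟩ : ∃ t, p = t + 2 := ⟨p - 2, by omega⟩
  obtain ⟨B, hB, hBcard, D, hlt, hfib, hmono, href⟩ :=
    exists_nested_labels n k t hn
      (fun i => if h : i < t + 2 then reduct A₀ (w ⟨i, h⟩) else []) A₀
      (fun i hi => by simpa only [dif_pos hi] using hperm ⟨i, hi⟩) (by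
        rw [hA₀m]
        refine Nat.mul_le_mul (Nat.pow_le_pow_right hn ?_)
          (Nat.pow_le_pow_right (by omega) (by omega))
        have : (t + 1) ^ 2 ≤ (q - 1) ^ 2 := Nat.pow_le_pow_left (by omega) 2
        nlinarith)
  have hne : B.Nonempty := Finset.card_pos.mp (by rw [hBcard]; positivity)
  have hblock : ∀ i (hi : i < t + 2), IsBlockFactorization (reduct B (w ⟨i, hi⟩))
      (n ^ (t + 1 - i) * k) (n ^ i) (fun j => (reduct B (w ⟨i, hi⟩)).filter (D i · = j)) := by
    intro i hi
    refine isBlockFactorization_filter (hBprop B hB hne _).2 (D i) _ _ ?_ (hlt i hi) (hfib i hi)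
    have := hmono i hi
    rw [dif_pos hi] at this
    rwa [reduct_eq_filter_reduct (hperm ⟨i, hi⟩) hB hne]
  refine ⟨B, hB.trans hA₀, t + 2, hp1, hpq, w, hw, hBcard, hBprop B hB hne, fun i hi => ?_⟩
  have e1 : t + 2 - (i + 1) = t + 1 - i := by omega
  have e2 : t + 2 - (i + 1) - 1 = t + 1 - (i + 1) := by omega
  rw [e2, e1]
  refine ⟨_, _, hblock i (by omega), hblock (i + 1) hi, fun j₁ => ?_⟩
  -- the block `j₁` is nonempty, and any of its letters determines the block of the next factor
  obtain ⟨a, ha⟩ := Finset.card_pos.mp ((Nat.pow_pos (n := i) hn).trans_eq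
    (hfib i (by omega) j₁ j₁.2).symm)
  obtain ⟨haB, haj⟩ := Finset.mem_filter.mp ha
  refine ⟨⟨D (i + 1) a, hlt (i + 1) hi a haB⟩, fun b hb => ?_⟩
  obtain ⟨hb, hbj⟩ := List.mem_filter.mp (List.mem_toFinset.mp hb)
  have hbB : b ∈ B := mem_of_mem_reduct hb
  refine List.mem_toFinset.mpr (List.mem_filter.mpr ⟨?_, ?_⟩)
  · exact List.count_pos_iff.mp (by rw [(hBprop B hB hne _).2.2.2 b hbB]; exact one_pos)
  · simpa using href i (by omega) b hbB a haB ((of_decide_eq_true hbj).trans haj.symm)
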